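/- Setting. For $n\ge 1$ let $h=2/n$, and consider the periodic mesh of $n$ points $x_j=jh$ on an interval of length $2$. Let $\alpha>0$, let $p\ge 1$ be odd, $s\ge 1$, $m\ge 1$ integers, and let $\delta t>0$ be tied to $h$ by a fixed CFL number $c=\alpha\,\delta t/h>0$ that is not an integer. For a time step $\tau$ write $\varepsilon^{(\tau)}=\frac{\alpha\tau}{h}-\lfloor\frac{\alpha\tau}{h}\rfloor$, and $$f_{p+1}(z)=\frac1{(p+1)!}\prod_{q=-(p+1)/2}^{(p-1)/2}(q+z).$$ Let $\mathcal S_p^{(\tau)}\in\mathbb R^{n\times n}$ be the semi-Lagrangian time-stepping matrix for $u_t+\alpha u_x=0$: $(\mathcal S_p^{(\tau)}v)_i$ is the value at $x_i-\alpha\tau$ of the polynomial of degree at most $p$ interpolating the periodic grid function $v$ at the mesh points $x_i+rh$, $-\lfloor\frac{\alpha\tau}{h}\rfloor-\frac{p+1}2\le r\le -\lfloor\frac{\alpha\tau}{h}\rfloor+\frac{p-1}2$. Let $\mathcal D_{p+1}\in\mathbb R^{n\times n}$ (one matrix for each $n$) be circulant and such that $h^{-(p+1)}\mathcal D_{p+1}$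 approximates the $(p+1)$st derivative to order $s$: for every $2$-periodic $v\in C^{p+1+s}$, $\big(h^{-(p+1)}\mathcal D_{p+1}(v(x_j))_j\big)_i=v^{(p+1)}(x_i)+O(h^s)$ uniformly in $i$ as $h\to0$. Let $$\Phi=\mathcal S_p^{(\delta t)},\qquad \Psi=\Big(I-\big[f_{p+1}(\varepsilon^{(m\delta t)})-m f_{p+1}(\varepsilon^{(\delta t)})\big]\mathcal D_{p+1}\Big)^{-1}\mathcal S_p^{(m\delta t)},$$ where the inverse is assumed to exist. The spatial Fourier modes are $\chi(\omega)=(e^{\mathrm i\omega x_j/h})_j$ with $\omega\in[-\pi,\pi)$, $\omega n\in2\pi\mathbb Z$. If $\lambda(\omega),\mu(\omega)$ are the eigenvalues of $\Phi,\Psi$ belonging to $\chi(\omega)$, put $$\widetilde A_1(\omega,m\theta)=1-\mu(\omega)e^{-\mathrm i m\theta},\qquad \widetilde A_1^{\rm ideal}(\omega,m\theta)=1-\lambda(\omega)^m e^{-\mathrm i m\theta},\qquad \theta\in\Theta^{\rm low}=[-\tfrac{\pi}{m},\tfrac{\pi}{m}).$$ Theorem (Improved coarse-grid correction). For all $K>0$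 and $\delta>0$ there are $C$ and $N$, depending only on $p,s,m,\alpha,c,K,\delta$ and the family $(\mathcal D_{p+1})_n$, such that for every $n\ge N$ for which the above inverse exists, and every asymptotically smooth frequency $\omega\neq0$, $|\omega|\le Kh$: the mode $\chi(\omega)$ is an eigenvector of both $\Phi$ and $\Psi$, and for all $\theta\in\Theta^{\rm low}$ one has $\widetilde A_1(\omega,m\theta)\ne0$ and $$\frac{\big|\widetilde A_1(\omega,m\theta)-\widetilde A_1^{\rm ideal}(\omega,m\theta)\big|}{\big|\widetilde A_1(\omega,m\theta)\big|}\le\begin{cases}C\,|\omega|^{p+2},&\big|\theta+\frac{\omega\alpha\,\delta t}{h}\big|\ge\delta\quad\text{(non-characteristic modes)},\\[1ex] C\,|\omega|,&\big|\theta+\frac{\omega\alpha\,\delta t}{h}\big|<\delta\quad\text{(characteristic components)}.\end{cases}$$ -/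

import Mathlib

namespace MGRIT

/-- Width `h = 2 / n` of the periodic mesh with `n` equispaced points on an interval of length
`2`, namely `(-1, 1)`. -/
noncomputable def meshWidth (n : ℕ) : ℝ := 2 / (n : ℝ)

/-- The mesh point `x_j = j h`, where `j` is taken modulo `n` and is represented by the integer of
least absolute value, so that `x_j ∈ (-1, 1]`. -/
noncomputable def meshPoint (n : ℕ) (j : ZMod n) : ℝ := (j.valMinAbs : ℝ) * meshWidth n

/-- The CFL number `α δt / h`. -/
noncomputable def cfl (α h δt : ℝ) : ℝ := α * δt / h

/-- The fractional part `ε^{(δt)} = c - ⌊c⌋` of the CFL number `c = α δt / h`. -/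
noncomputable def cflFrac (α h δt : ℝ) : ℝ := cfl α h δt - (⌊cfl α h δt⌋ : ℝ)

/-- For odd `p`, the polynomial `f_{p+1}(z) = (1 / (p+1)!) ∏_{q = -(p+1)/2}^{(p-1)/2} (q + z)`. -/
noncomputable def fPoly (p : ℕ) (z : ℝ) : ℝ :=
  1 / (Nat.factorial (p + 1) : ℝ) *
    ∏ q ∈ Finset.Icc (-(((p : ℤ) + 1) / 2)) (((p : ℤ) - 1) / 2), ((q : ℝ) + z)

/-- For odd `p`, the offsets `r` (relative to the arrival point `x_i`) of the `p + 1` mesh points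
`x_i + r h` nearest to the departure point `x_i - α δt`: there are `(p+1)/2` of them on
either side, the east neighbour of the departure point having offset `-⌊α δt / h⌋`. -/
noncomputable def stencil (p : ℕ) (c : ℝ) : Finset ℤ :=
  Finset.Icc (-⌊c⌋ - ((p : ℤ) + 1) / 2) (-⌊c⌋ + ((p : ℤ) - 1) / 2)

/-- One step of the semi-Lagrangian discretization of `u_t + α u_x = 0` (order `p` odd, time step
`δt`) on periodic grid functions: the new value at `x_i` is the value at the departure point
`x_i - α δt` of the polynomial of degree at most `p` that interpolates the old grid function at the
stencil points `x_i + r h`. Positions are measured relative to `x_i`. -/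
noncomputable def semiLagrangianStep (p : ℕ) (α δt : ℝ) (n : ℕ) :
    (ZMod n → ℝ) →ₗ[ℝ] (ZMod n → ℝ) where
  toFun v i := Polynomial.eval (-(α * δt))
    (Lagrange.interpolate (stencil p (cfl α (meshWidth n) δt))
      (fun r : ℤ => (r : ℝ) * meshWidth n) (fun r : ℤ => v (i + (r : ZMod n))))
  map_add' v w := by
    funext i
    rw [Pi.add_apply, ← Polynomial.eval_add, ← map_add]
    rfl
  map_smul' a v := by
    funext i
    rw [Pi.smul_apply, RingHom.id_apply, ← Polynomial.eval_smul, ← map_smul]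
    rfl

/-- The time-stepping matrix `S_p^{(δt)}` of the semi-Lagrangian discretization. -/
noncomputable def semiLagrangian (p : ℕ) (α δt : ℝ) (n : ℕ) [NeZero n] :
    Matrix (ZMod n) (ZMod n) ℝ :=
  LinearMap.toMatrix' (semiLagrangianStep p α δt n)

/-- The family of matrices `D n` (one for every mesh) is such that `h^{-k} D n` is a circulant
difference rule of order `s` for the `k`-th derivative of periodic grid functions: for every
periodic function `v` that is `k + s` times continuously differentiable,
`(h^{-k} D v)_i = v^{(k)}(x_i) + O(h^s)`, uniformly in `i`, as `h → 0`. -/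
def IsDifferenceRule (D : ∀ (n : ℕ) [NeZero n], Matrix (ZMod n) (ZMod n) ℝ) (k s : ℕ) : Prop :=
  (∀ (n : ℕ) [NeZero n], ∃ a : ZMod n → ℝ, D n = Matrix.circulant a) ∧
  ∀ v : ℝ → ℝ, Function.Periodic v 2 → ContDiff ℝ ((k + s : ℕ) : WithTop ℕ∞) v →
    ∃ (C : ℝ) (N : ℕ), ∀ (n : ℕ) [NeZero n], N ≤ n → ∀ i : ZMod n,
      |((D n).mulVec (fun j => v (meshPoint n j)) i) / meshWidth n ^ k
        - iteratedDeriv k v (meshPoint n i)| ≤ C * meshWidth n ^ s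

/-- The matrix `I - [f_{p+1}(ε^{(mδt)}) - m f_{p+1}(ε^{(δt)})] D` of the truncation error
correction. -/
noncomputable def correctionMatrix (p m : ℕ) (α δt : ℝ) (n : ℕ) [NeZero n]
    (D : Matrix (ZMod n) (ZMod n) ℝ) : Matrix (ZMod n) (ZMod n) ℝ :=
  1 - (fPoly p (cflFrac α (meshWidth n) ((m : ℝ) * δt))
        - (m : ℝ) * fPoly p (cflFrac α (meshWidth n) δt)) • D

/-- The modified coarse-grid time-stepping operator
`Ψ = (I - [f_{p+1}(ε^{(mδt)}) - m f_{p+1}(ε^{(δt)})] D)⁻¹ S_p^{(mδt)}`. -/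
noncomputable def modifiedCoarse (p m : ℕ) (α δt : ℝ) (n : ℕ) [NeZero n]
    (D : Matrix (ZMod n) (ZMod n) ℝ) : Matrix (ZMod n) (ZMod n) ℝ :=
  (correctionMatrix p m α δt n D)⁻¹ * semiLagrangian p α ((m : ℝ) * δt) n

/-- The frequencies `ω ∈ [-π, π)` of the `n` spatial Fourier modes that are periodic on the mesh. -/
def IsSpatialFrequency (n : ℕ) (ω : ℝ) : Prop :=
  ω ∈ Set.Ico (-Real.pi) Real.pi ∧ ∃ k : ℤ, ω * (n : ℝ) = 2 * Real.pi * (k : ℝ)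

/-- The spatial Fourier mode `χ(ω) = exp(i ω x / h)` on the mesh. -/
noncomputable def fourierMode (n : ℕ) (ω : ℝ) : ZMod n → ℂ := fun j =>
  Complex.exp (Complex.I * ((ω * meshPoint n j / meshWidth n : ℝ) : ℂ))

/-- `z` is the Fourier symbol of the matrix `M` at frequency `ω`: the eigenvalue of `M` that
belongs to the spatial Fourier mode `χ(ω)`. -/
def HasFourierSymbol {n : ℕ} [NeZero n] (M : Matrix (ZMod n) (ZMod n) ℝ) (ω : ℝ) (z : ℂ) : Prop :=
  (M.map (fun x : ℝ => (x : ℂ))).mulVec (fourierMode n ω) = z • fourierMode n ω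

/-- The low temporal frequencies `Θ^low = [-π/m, π/m)`. -/
noncomputable def lowFrequencies (m : ℕ) : Set ℝ :=
  Set.Ico (-(Real.pi / (m : ℝ))) (Real.pi / (m : ℝ))

/-- The space-time Fourier symbol `1 - z e^{-i m θ}` of the coarse-grid discretization whose
time-stepping operator has the spatial Fourier symbol `z`. -/
noncomputable def coarseSymbol (m : ℕ) (z : ℂ) (θ : ℝ) : ℂ :=
  1 - z * Complex.exp (-(Complex.I * ((m : ℂ) * (θ : ℂ))))

/-- The relative coarse-grid error `|A₁ - A₁^ideal| / |A₁|` of a space-time Fourier mode, where the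
fine- and coarse-grid time-stepping operators have the spatial symbols `lam` and `mu`; the ideal
coarse-grid operator `Φ^m` has the symbol `lam ^ m`. -/
noncomputable def coarseGridError (m : ℕ) (lam mu : ℂ) (θ : ℝ) : ℝ :=
  ‖coarseSymbol m mu θ - coarseSymbol m (lam ^ m) θ‖ / ‖coarseSymbol m mu θ‖

end MGRIT

/-! ### Moments of the interpolation weights and expansion of the semi-Lagrangian symbol -/

namespace MGRIT

open Asymptotics Filter Topology

/-! After removal of the exact phase, the semi-Lagrangian symbol with CFL number c is 1 - f(ε)
(iω)^(p+1) + O(ω^(p+2)), where ε is the fractional part of c and f is `fPoly p`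
(`slSymbol_expansion`): interpolation is exact up to degree p, and the nodal polynomial gives the
next moment. The difference rule has symbol (iω)^(p+1) + O(ω^(p+2)) at the finitely many admissible
wave numbers. The correction therefore replaces the coefficient f(ε_m) of the coarse step, with ε_m
the fractional part of mc, by m f(ε), which is that of λ^m. Both share the phase e^(-iωmc), so μ -
λ^m = O(ω^(p+2)) (`exists_symbol_bounds`).

The numerator of the relative error is |μ - λ^m|, independently of θ. For the denominator, i^(p+1)
f(ε) > 0 makes the leading term dissipative, so |1 - μ e^(-imθ)| ≥ 1 - |μ| ≥ c₀ |ω|^(p+1) always;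
this costs all but one power of ω. Away from the characteristic, the phase-shifted μ is close to 1
while e^(-im(θ+ωc)) stays away from 1, so the denominator is bounded below and no power is lost. -/

/-- The weight of the stencil point with offset `r` in the semi-Lagrangian scheme with CFL number
`c`. -/
noncomputable def stencilWeight (p : ℕ) (c : ℝ) (r : ℤ) : ℝ :=
  (Lagrange.basis (stencil p c) (fun r : ℤ => (r : ℝ)) r).eval (-c)

lemma card_stencil {p : ℕ} (hp : Odd p) (c : ℝ) : (stencil p c).card = p + 1 := by
  obtain ⟨k, rfl⟩ := hp
  rw [stencil, Int.card_Icc]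
  push_cast
  omega

lemma intCast_injOn (s : Set ℤ) : Set.InjOn (fun r : ℤ => (r : ℝ)) s :=
  fun _ _ _ _ h => Int.cast_injective h

/-- Lagrange interpolation on p + 1 nodes reproduces polynomials of degree at most p; all moments of
the weights follow from this. -/
lemma sum_stencilWeight_mul_eval {p : ℕ} (hp : Odd p) (c : ℝ) (P : Polynomial ℝ)
    (hP : P.degree < ((p + 1 : ℕ) : WithBot ℕ)) :
    ∑ r ∈ stencil p c, stencilWeight p c r * P.eval (r : ℝ) = P.eval (-c) := by
  rw [← card_stencil hp c] at hP
  conv_rhs => rw [Lagrange.eq_interpolate (intCast_injOn (stencil p c)) hP,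
    Lagrange.interpolate_apply, Polynomial.eval_finsetSum]
  refine Finset.sum_congr rfl fun r _ => ?_
  rw [Polynomial.eval_mul, Polynomial.eval_C, mul_comm, stencilWeight]

lemma prod_stencil_eq {p : ℕ} (hp : Odd p) (c : ℝ) :
    ∏ r ∈ stencil p c, (-c - (r : ℝ)) = (Nat.factorial (p + 1) : ℝ) * fPoly p (Int.fract c) := by
  rw [fPoly, ← mul_assoc, mul_one_div_cancel (by positivity), one_mul]
  have h1 : ∏ r ∈ stencil p c, (-c - (r : ℝ)) = ∏ r ∈ stencil p c, (c + (r : ℝ)) := by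
    have h2 : ∀ r ∈ stencil p c, (-c - (r : ℝ)) = (-1) * (c + r) := fun r _ => by ring
    rw [Finset.prod_congr rfl h2, Finset.prod_mul_distrib, Finset.prod_const, card_stencil hp,
      hp.add_one.neg_one_pow, one_mul]
  rw [h1]
  -- The sign has dropped out because p + 1 is even; shifting offsets by `⌊c⌋` leaves only the
  -- fractional part.
  refine Finset.prod_bij' (fun r _ => r + ⌊c⌋) (fun q _ => q - ⌊c⌋) ?_ ?_ ?_ ?_ ?_
  · intro r hr
    simp only [stencil, Finset.mem_Icc] at hr ⊢
    omega
  · intro r hr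
    simp only [stencil, Finset.mem_Icc] at hr ⊢
    omega
  · intro r _; ring
  · intro r _; ring
  · intro r _
    rw [Int.fract]
    push_cast
    ring

lemma sum_stencilWeight_mul_pow {p k : ℕ} (hp : Odd p) (c : ℝ) (hk : k ≤ p) :
    ∑ r ∈ stencil p c, stencilWeight p c r * ((r : ℝ) + c) ^ k = 0 ^ k := by
  have h := sum_stencilWeight_mul_eval hp c ((Polynomial.X + Polynomial.C c) ^ k) (by
    rw [Polynomial.degree_pow, Polynomial.degree_X_add_C, nsmul_one]
    exact_mod_cast Nat.lt_succ_of_le hk)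
  simpa using h

/-- The first moment that interpolation misses. Subtracting the monic nodal polynomial from (X +
c)^(p+1) leaves degree at most p, where interpolation is exact; the nodal polynomial vanishes at the
nodes, so only its value at -c survives. -/
lemma sum_stencilWeight_mul_pow_succ {p : ℕ} (hp : Odd p) (c : ℝ) :
    ∑ r ∈ stencil p c, stencilWeight p c r * ((r : ℝ) + c) ^ (p + 1)
      = -((Nat.factorial (p + 1) : ℝ) * fPoly p (Int.fract c)) := by
  set N := Lagrange.nodal (stencil p c) (fun r : ℤ => (r : ℝ)) with hN
  have hdeg : ((Polynomial.X + Polynomial.C c) ^ (p + 1)).degree = ((p + 1 : ℕ) : WithBot ℕ) := by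
    rw [Polynomial.degree_pow, Polynomial.degree_X_add_C, nsmul_one]
  have h := sum_stencilWeight_mul_eval hp c ((Polynomial.X + Polynomial.C c) ^ (p + 1) - N) (by
    rw [← hdeg]
    refine Polynomial.degree_sub_lt_left ?_ ?_ ?_
    · rw [hdeg, hN, Lagrange.degree_nodal, card_stencil hp]
    · exact pow_ne_zero _ (Polynomial.X_add_C_ne_zero c)
    · rw [((Polynomial.monic_X_add_C c).pow _).leadingCoeff, hN,
        (Lagrange.nodal_monic).leadingCoeff])
  rw [Polynomial.eval_sub, hN, Lagrange.eval_nodal, prod_stencil_eq hp] at h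
  simp only [Polynomial.eval_pow, Polynomial.eval_add, Polynomial.eval_X, Polynomial.eval_C,
    neg_add_cancel] at h
  rw [zero_pow (Nat.succ_ne_zero p), zero_sub] at h
  rw [← h]
  refine Finset.sum_congr rfl fun r hr => ?_
  rw [Polynomial.eval_sub, Lagrange.eval_nodal_at_node (v := fun r : ℤ => (r : ℝ)) hr, sub_zero]
  simp

/-- `i ^ (p + 1) f_{p+1}(z) > 0` for `0 < z < 1`: the leading truncation error is dissipative. -/
lemma neg_one_pow_mul_fPoly_pos {p k : ℕ} (hp : p = 2 * k + 1) {z : ℝ} (hz : 0 < z)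
    (hz1 : z < 1) : 0 < (-1) ^ (k + 1) * fPoly p z := by
  subst hp
  rw [fPoly, mul_left_comm]
  refine mul_pos (by positivity) ?_
  have e1 : (((2 * k + 1 : ℕ) : ℤ) + 1) / 2 = k + 1 := by push_cast; omega
  have e2 : (((2 * k + 1 : ℕ) : ℤ) - 1) / 2 = k := by push_cast; omega
  rw [e1, e2]
  have hu : Finset.Icc (-((k : ℤ) + 1)) k
      = Finset.Icc (-((k : ℤ) + 1)) (-1) ∪ Finset.Icc 0 (k : ℤ) := by
    ext x
    simp only [Finset.mem_union, Finset.mem_Icc]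
    omega
  have hdj : Disjoint (Finset.Icc (-((k : ℤ) + 1)) (-1)) (Finset.Icc 0 (k : ℤ)) := by
    rw [Finset.disjoint_left]
    intro x
    simp only [Finset.mem_Icc]
    omega
  have hc : (Finset.Icc (-((k : ℤ) + 1)) (-1)).card = k + 1 := by
    rw [Int.card_Icc]
    omega
  -- The k + 1 factors with q ≤ -1 are negative, and each absorbs one factor -1 of the sign; those
  -- with q ≥ 0 are positive.
  rw [hu, Finset.prod_union hdj, ← mul_assoc, ← hc, ← Finset.prod_const, ← Finset.prod_mul_distrib]
  refine mul_pos (Finset.prod_pos fun q hq => ?_) (Finset.prod_pos fun q hq => ?_)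
  · have : (q : ℝ) ≤ -1 := by exact_mod_cast (Finset.mem_Icc.1 hq).2
    linarith
  · have : (0 : ℝ) ≤ q := by exact_mod_cast (Finset.mem_Icc.1 hq).1
    linarith

/-- The Fourier symbol of the semi-Lagrangian scheme with CFL number `c`. -/
noncomputable def slSymbol (p : ℕ) (c ω : ℝ) : ℂ :=
  ∑ r ∈ stencil p c, (stencilWeight p c r : ℂ) * Complex.exp (Complex.I * ((ω * r : ℝ) : ℂ))

lemma exp_sub_taylor_isBigO (n : ℕ) (a : ℝ) :
    (fun ω : ℝ => Complex.exp (Complex.I * ((ω * a : ℝ) : ℂ))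
      - ∑ k ∈ Finset.range n, (Complex.I * ((ω * a : ℝ) : ℂ)) ^ k / (Nat.factorial k : ℂ))
      =O[𝓝 0] fun ω : ℝ => ω ^ n := by
  refine IsBigO.of_bound (|a| ^ n * Real.exp |a|) ?_
  filter_upwards [Metric.ball_mem_nhds (0 : ℝ) one_pos] with ω hω
  rw [mem_ball_zero_iff, Real.norm_eq_abs] at hω
  have hn : ‖Complex.I * ((ω * a : ℝ) : ℂ)‖ = |ω| * |a| := by
    rw [norm_mul, Complex.norm_I, one_mul, Complex.norm_real, Real.norm_eq_abs, abs_mul]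
  refine (Complex.norm_exp_sub_sum_le_norm_mul_exp _ n).trans ?_
  rw [hn, mul_pow, norm_pow, Real.norm_eq_abs]
  have : Real.exp (|ω| * |a|) ≤ Real.exp |a| :=
    Real.exp_le_exp.2 (mul_le_of_le_one_left (abs_nonneg a) hω.le)
  calc |ω| ^ n * |a| ^ n * Real.exp (|ω| * |a|) ≤ |ω| ^ n * |a| ^ n * Real.exp |a| := by gcongr
    _ = _ := by ring

lemma slSymbol_expansion {p : ℕ} (hp : Odd p) (c : ℝ) :
    (fun ω : ℝ => Complex.exp (Complex.I * ((ω * c : ℝ) : ℂ)) * slSymbol p c ω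
      - (1 - (fPoly p (Int.fract c) : ℂ) * (Complex.I * (ω : ℂ)) ^ (p + 1)))
      =O[𝓝 0] fun ω : ℝ => ω ^ (p + 2) := by
  have key := IsBigO.sum (s := stencil p c) (l := 𝓝 (0 : ℝ)) (g := fun ω : ℝ => ω ^ (p + 2))
    (A := fun r ω => (stencilWeight p c r : ℂ) *
      (Complex.exp (Complex.I * ((ω * ((r : ℝ) + c) : ℝ) : ℂ))
      - ∑ k ∈ Finset.range (p + 2),
        (Complex.I * ((ω * ((r : ℝ) + c) : ℝ) : ℂ)) ^ k / (Nat.factorial k : ℂ)))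
    (fun r _ => (exp_sub_taylor_isBigO (p + 2) ((r : ℝ) + c)).const_mul_left _)
  refine key.congr_left fun ω => ?_
  simp only [mul_sub, Finset.sum_sub_distrib, Finset.sum_apply]
  congr 1
  · rw [slSymbol, Finset.mul_sum]
    refine Finset.sum_congr rfl fun r _ => ?_
    rw [mul_left_comm, ← Complex.exp_add]
    congr 2
    push_cast
    ring
  · simp only [Finset.mul_sum]
    rw [Finset.sum_comm]
    have hk : ∀ k, ∑ r ∈ stencil p c, (stencilWeight p c r : ℂ) *
        ((Complex.I * ((ω * ((r : ℝ) + c) : ℝ) : ℂ)) ^ k / (Nat.factorial k : ℂ))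
        = (Complex.I * (ω : ℂ)) ^ k / (Nat.factorial k : ℂ) *
        ((∑ r ∈ stencil p c, stencilWeight p c r * ((r : ℝ) + c) ^ k : ℝ) : ℂ) := by
      intro k
      push_cast
      rw [Finset.mul_sum]
      refine Finset.sum_congr rfl fun r _ => ?_
      rw [← mul_assoc Complex.I, mul_pow]
      ring
    simp only [hk]
    -- Only k = 0 and k = p + 1 contribute; the moments in between vanish.
    rw [Finset.sum_range_succ, sum_stencilWeight_mul_pow_succ hp, Finset.sum_range_succ']
    rw [Finset.sum_eq_zero, sum_stencilWeight_mul_pow hp c (Nat.zero_le p)]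
    · have : (Nat.factorial (p + 1) : ℂ) ≠ 0 := by exact_mod_cast (Nat.factorial_ne_zero _)
      push_cast
      field_simp
      simp
      ring
    · intro k hk
      rw [sum_stencilWeight_mul_pow hp c (Finset.mem_range.1 hk)]
      simp

end MGRIT

/-! ### Fourier modes and symbols of mesh matrices -/

namespace MGRIT

open Matrix

lemma meshWidth_pos (n : ℕ) [NeZero n] : 0 < meshWidth n := by
  have : 0 < n := NeZero.pos n
  unfold meshWidth
  positivity

lemma fourierMode_apply (n : ℕ) [NeZero n] (ω : ℝ) (j : ZMod n) :
    fourierMode n ω j = Complex.exp (Complex.I * ((ω * (j.valMinAbs : ℝ) : ℝ) : ℂ)) := by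
  have := (meshWidth_pos n).ne'
  rw [fourierMode, meshPoint]
  congr 4
  field_simp

/-- Since ωn is a multiple of 2π, any integer representative of the mesh index gives the same value;
this makes the mode a character of `ZMod n`. -/
lemma fourierMode_intCast {n : ℕ} [NeZero n] {ω : ℝ} (hω : IsSpatialFrequency n ω) (r : ℤ) :
    fourierMode n ω (r : ZMod n) = Complex.exp (Complex.I * ((ω * (r : ℝ) : ℝ) : ℂ)) := by
  obtain ⟨-, k, hk⟩ := hω
  rw [fourierMode_apply]
  have h : (((r : ZMod n).valMinAbs : ℤ) : ZMod n) = (r : ZMod n) := ZMod.coe_valMinAbs _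
  rw [ZMod.intCast_eq_intCast_iff_dvd_sub] at h
  obtain ⟨t, ht⟩ := h
  rw [Complex.exp_eq_exp_iff_exists_int]
  refine ⟨-(k * t), ?_⟩
  have e1 : (((r : ZMod n).valMinAbs : ℤ) : ℝ) = r - n * t := by
    have : ((r : ZMod n).valMinAbs : ℤ) = r - n * t := by omega
    rw [this]
    push_cast
    ring
  rw [e1, mul_sub, ← mul_assoc ω, hk]
  push_cast
  ring

lemma fourierMode_add {n : ℕ} [NeZero n] {ω : ℝ} (hω : IsSpatialFrequency n ω) (i j : ZMod n) :
    fourierMode n ω (i + j) = fourierMode n ω i * fourierMode n ω j := by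
  rw [← ZMod.coe_valMinAbs i, ← ZMod.coe_valMinAbs j, ← Int.cast_add, fourierMode_intCast hω,
    fourierMode_intCast hω, fourierMode_intCast hω, ← Complex.exp_add]
  congr 1
  push_cast
  ring

lemma fourierMode_zero (n : ℕ) [NeZero n] (ω : ℝ) : fourierMode n ω 0 = 1 := by
  simp [fourierMode_apply]

lemma eval_basis_mul_right (s : Finset ℤ) {h : ℝ} (hh : h ≠ 0) (x : ℝ) (r : ℤ) :
    (Lagrange.basis s (fun r : ℤ => (r : ℝ) * h) r).eval (x * h)
      = (Lagrange.basis s (fun r : ℤ => (r : ℝ)) r).eval x := by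
  rw [Lagrange.basis, Lagrange.basis, Polynomial.eval_prod, Polynomial.eval_prod]
  refine Finset.prod_congr rfl fun j _ => ?_
  simp only [Lagrange.basisDivisor, Polynomial.eval_mul, Polynomial.eval_C, Polynomial.eval_sub,
    Polynomial.eval_X]
  rw [← sub_mul, ← sub_mul, mul_inv, mul_mul_mul_comm, inv_mul_cancel₀ hh, mul_one]

lemma semiLagrangianStep_apply {n : ℕ} [NeZero n] (p : ℕ) {α δt c : ℝ}
    (hc : cfl α (meshWidth n) δt = c) (v : ZMod n → ℝ) (i : ZMod n) :
    semiLagrangianStep p α δt n v i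
      = ∑ r ∈ stencil p c, stencilWeight p c r * v (i + (r : ZMod n)) := by
  have hh := (meshWidth_pos n).ne'
  have hx : -(α * δt) = -c * meshWidth n := by
    rw [← hc, cfl]
    field_simp
  change Polynomial.eval (-(α * δt)) (Lagrange.interpolate (stencil p (cfl α (meshWidth n) δt))
      (fun r : ℤ => (r : ℝ) * meshWidth n) (fun r : ℤ => v (i + (r : ZMod n)))) = _
  rw [hc, hx, Lagrange.interpolate_apply, Polynomial.eval_finsetSum]
  refine Finset.sum_congr rfl fun r _ => ?_
  rw [Polynomial.eval_mul, Polynomial.eval_C, eval_basis_mul_right _ hh, mul_comm, stencilWeight]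

lemma hasFourierSymbol_semiLagrangian {n : ℕ} [NeZero n] (p : ℕ) {α δt c ω : ℝ}
    (hc : cfl α (meshWidth n) δt = c) (hω : IsSpatialFrequency n ω) :
    HasFourierSymbol (semiLagrangian p α δt n) ω (slSymbol p c ω) := by
  funext i
  simp only [mulVec, dotProduct, map_apply, semiLagrangian, LinearMap.toMatrix'_apply,
    semiLagrangianStep_apply p hc, Pi.smul_apply, smul_eq_mul, slSymbol]
  push_cast
  simp only [Finset.sum_mul]
  rw [Finset.sum_comm]
  refine Finset.sum_congr rfl fun r _ => ?_
  rw [Finset.sum_eq_single (i + (r : ZMod n))]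
  · rw [fourierMode_add hω, fourierMode_intCast hω]
    simp
    ring
  · intro j _ hj
    simp [hj.symm]
  · simp

lemma exists_hasFourierSymbol_circulant {n : ℕ} [NeZero n] (a : ZMod n → ℝ) {ω : ℝ}
    (hω : IsSpatialFrequency n ω) : ∃ d, HasFourierSymbol (circulant a) ω d := by
  refine ⟨∑ j, (a (-j) : ℂ) * fourierMode n ω j, ?_⟩
  funext i
  simp only [mulVec, dotProduct, map_apply, circulant_apply, Pi.smul_apply, smul_eq_mul]
  rw [Finset.sum_mul, ← Equiv.sum_comp (Equiv.addLeft i)]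
  refine Finset.sum_congr rfl fun j _ => ?_
  simp only [Equiv.coe_addLeft]
  rw [fourierMode_add hω, sub_add_cancel_left]
  ring

lemma HasFourierSymbol.eq_mulVec_zero {n : ℕ} [NeZero n] {M : Matrix (ZMod n) (ZMod n) ℝ}
    {ω : ℝ} {d : ℂ} (h : HasFourierSymbol M ω d) :
    d = (M.map (fun x : ℝ => (x : ℂ)) *ᵥ fourierMode n ω) 0 := by
  have h' : M.map (fun x : ℝ => (x : ℂ)) *ᵥ fourierMode n ω = d • fourierMode n ω := h
  rw [h', Pi.smul_apply, fourierMode_zero, smul_eq_mul, mul_one]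

/-- The symbol of a matrix in terms of its action on the grid functions `cos` and `sin`. -/
lemma HasFourierSymbol.eq_cos_add_sin {n : ℕ} [NeZero n] {M : Matrix (ZMod n) (ZMod n) ℝ}
    {ω a : ℝ} {d : ℂ} (h : HasFourierSymbol M ω d) (ha : ω = a * meshWidth n) :
    d = ((M *ᵥ fun j => Real.cos (a * meshPoint n j)) 0 : ℝ)
      + ((M *ᵥ fun j => Real.sin (a * meshPoint n j)) 0 : ℝ) * Complex.I := by
  rw [h.eq_mulVec_zero]
  simp only [mulVec, dotProduct, map_apply]
  push_cast
  rw [Finset.sum_mul, ← Finset.sum_add_distrib]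
  refine Finset.sum_congr rfl fun j _ => ?_
  have hh := (meshWidth_pos n).ne'
  have e : ω * meshPoint n j / meshWidth n = a * meshPoint n j := by
    rw [ha]
    field_simp
  rw [fourierMode, e, mul_comm Complex.I, Complex.exp_mul_I]
  push_cast
  ring

lemma HasFourierSymbol.one_sub_smul {n : ℕ} [NeZero n] {M : Matrix (ZMod n) (ZMod n) ℝ}
    {ω : ℝ} {d : ℂ} (h : HasFourierSymbol M ω d) (g : ℝ) :
    HasFourierSymbol (1 - g • M) ω (1 - g * d) := by
  have h' : M.map (fun x : ℝ => (x : ℂ)) *ᵥ fourierMode n ω = d • fourierMode n ω := h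
  have e : (1 - g • M).map (fun x : ℝ => (x : ℂ))
      = 1 - (g : ℂ) • M.map (fun x : ℝ => (x : ℂ)) := by
    ext i j
    by_cases hij : i = j <;> simp [hij]
  rw [HasFourierSymbol, e, sub_mulVec, smul_mulVec, h', one_mulVec, sub_smul, one_smul, smul_smul]

lemma HasFourierSymbol.inv_mul {n : ℕ} [NeZero n] {M S : Matrix (ZMod n) (ZMod n) ℝ}
    {ω : ℝ} {d z : ℂ} (hM : HasFourierSymbol M ω d) (hS : HasFourierSymbol S ω z)
    (hu : IsUnit M) (hd : d ≠ 0) : HasFourierSymbol (M⁻¹ * S) ω (d⁻¹ * z) := by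
  have hM' : M.map (Complex.ofRealHom) *ᵥ fourierMode n ω = d • fourierMode n ω := hM
  have hS' : S.map (Complex.ofRealHom) *ᵥ fourierMode n ω = z • fourierMode n ω := hS
  change (M⁻¹ * S).map Complex.ofRealHom *ᵥ fourierMode n ω = _
  have hinv : M⁻¹.map (Complex.ofRealHom) *ᵥ fourierMode n ω = d⁻¹ • fourierMode n ω := by
    have h1 : M⁻¹.map (Complex.ofRealHom) * M.map (Complex.ofRealHom) = 1 := by
      rw [← Matrix.map_mul, Matrix.nonsing_inv_mul _ ((Matrix.isUnit_iff_isUnit_det M).1 hu)]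
      simp
    have h2 := congrArg (fun w => M⁻¹.map (Complex.ofRealHom) *ᵥ w) hM'
    simp only [mulVec_mulVec, h1, one_mulVec, mulVec_smul] at h2
    rw [h2, smul_smul, inv_mul_cancel₀ hd, one_smul, ← h2]
  rw [Matrix.map_mul, ← mulVec_mulVec, hS', mulVec_smul, hinv, smul_smul, mul_comm]

lemma iteratedDeriv_cos_mul_zero (k : ℕ) (a : ℝ) :
    iteratedDeriv (2 * k) (fun x => Real.cos (a * x)) 0 = (-1) ^ k * a ^ (2 * k) := by
  rw [iteratedDeriv_comp_const_mul Real.contDiff_cos]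
  simp only [mul_zero, Real.iteratedDeriv_even_cos]
  simp [mul_comm ((-1 : ℝ) ^ k)]

lemma iteratedDeriv_sin_mul_zero (k : ℕ) (a : ℝ) :
    iteratedDeriv (2 * k) (fun x => Real.sin (a * x)) 0 = 0 := by
  rw [iteratedDeriv_comp_const_mul Real.contDiff_sin]
  simp

lemma meshPoint_zero (n : ℕ) : meshPoint n 0 = 0 := by simp [meshPoint]

/-- A difference rule of even order `2 k` has symbol `(i ω) ^ (2 k) + O(h ^ (2 k + s))`. -/
lemma IsDifferenceRule.symbol_bound
    {D : ∀ (n : ℕ) [NeZero n], Matrix (ZMod n) (ZMod n) ℝ} {k s : ℕ}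
    (hD : IsDifferenceRule D (2 * k) s) (l : ℤ) :
    ∃ (B : ℝ) (N : ℕ), ∀ (n : ℕ) [NeZero n], N ≤ n → ∀ d : ℂ,
      HasFourierSymbol (D n) (Real.pi * l * meshWidth n) d →
      ‖d - (Complex.I * ((Real.pi * l * meshWidth n : ℝ) : ℂ)) ^ (2 * k)‖
        ≤ B * meshWidth n ^ (2 * k + s) := by
  have hper : ∀ x : ℝ, Real.pi * l * (x + 2) = Real.pi * l * x + l * (2 * Real.pi) :=
    fun x => by ring
  -- The accuracy assumption concerns one fixed function at a time, so it is tested on cos(πlx) and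
  -- sin(πlx), and the constants depend on l.
  obtain ⟨C₁, N₁, h₁⟩ := hD.2 (fun x => Real.cos (Real.pi * l * x))
    (fun x => by simp only [hper]; exact Real.cos_add_int_mul_two_pi _ l)
    (Real.contDiff_cos.comp (contDiff_const.mul contDiff_id))
  obtain ⟨C₂, N₂, h₂⟩ := hD.2 (fun x => Real.sin (Real.pi * l * x))
    (fun x => by simp only [hper]; exact Real.sin_add_int_mul_two_pi _ l)
    (Real.contDiff_sin.comp (contDiff_const.mul contDiff_id))
  refine ⟨C₁ + C₂, max N₁ N₂, fun n _ hn d hd => ?_⟩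
  have hh := meshWidth_pos n
  have b₁ := h₁ n ((le_max_left _ _).trans hn) 0
  have b₂ := h₂ n ((le_max_right _ _).trans hn) 0
  rw [meshPoint_zero, iteratedDeriv_cos_mul_zero] at b₁
  rw [meshPoint_zero, iteratedDeriv_sin_mul_zero] at b₂
  rw [hd.eq_cos_add_sin rfl]
  set X := (D n *ᵥ fun j => Real.cos (Real.pi * l * meshPoint n j)) 0
  set Y := (D n *ᵥ fun j => Real.sin (Real.pi * l * meshPoint n j)) 0
  set h := meshWidth n
  set a := Real.pi * (l : ℝ)
  have e : (X : ℂ) + Y * Complex.I - (Complex.I * ((a * h : ℝ) : ℂ)) ^ (2 * k)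
      = (h : ℂ) ^ (2 * k) * (((X / h ^ (2 * k) - (-1) ^ k * a ^ (2 * k) : ℝ) : ℂ)
        + ((Y / h ^ (2 * k) - 0 : ℝ) : ℂ) * Complex.I) := by
    have hne : (h : ℂ) ≠ 0 := by exact_mod_cast hh.ne'
    rw [mul_pow, pow_mul Complex.I, Complex.I_sq]
    push_cast
    field_simp
    ring
  rw [e, norm_mul, norm_pow, Complex.norm_real, Real.norm_eq_abs, abs_of_pos hh]
  calc h ^ (2 * k) * _ ≤ h ^ (2 * k) * (C₁ * h ^ s + C₂ * h ^ s) := by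
        gcongr
        refine (norm_add_le _ _).trans (add_le_add ?_ ?_)
        · rwa [Complex.norm_real, Real.norm_eq_abs]
        · rwa [norm_mul, Complex.norm_I, mul_one, Complex.norm_real, Real.norm_eq_abs]
    _ = _ := by ring

end MGRIT

/-! ### First-order expansions and uniform bounds on the symbols -/

namespace MGRIT

open Asymptotics Filter Topology

section FirstOrder

variable {X : Type*} {l : Filter X} {W u v : X → ℂ} {g : X → ℝ} {a b : ℂ}

lemma tendsto_one_of_firstOrder (hW : Tendsto W l (𝓝 0)) (hg : Tendsto g l (𝓝 0))
    (hu : (fun x => u x - (1 - a * W x)) =O[l] g) : Tendsto u l (𝓝 1) := by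
  have h1 := (hu.trans_tendsto hg).add ((tendsto_const_nhds (x := (1 : ℂ))).sub (hW.const_mul a))
  simpa using h1

/-- With W² absorbed into the error g, expressions 1 - aW + O(g) multiply by adding their
coefficients; inverses and powers follow. -/
lemma firstOrder_mul (hW : Tendsto W l (𝓝 0)) (hg : Tendsto g l (𝓝 0))
    (hWW : (fun x => W x * W x) =O[l] g)
    (hu : (fun x => u x - (1 - a * W x)) =O[l] g) (hv : (fun x => v x - (1 - b * W x)) =O[l] g) :
    (fun x => u x * v x - (1 - (a + b) * W x)) =O[l] g := by
  have hv1 := (tendsto_one_of_firstOrder hW hg hv).isBigO_one ℝ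
  have hw1 : (fun x => 1 - a * W x) =O[l] fun _ => (1 : ℝ) :=
    ((tendsto_const_nhds (x := (1 : ℂ))).sub (hW.const_mul a)).isBigO_one ℝ
  have h := ((hu.mul hv1).add ((hw1.mul hv).congr_right fun x => by ring)).add
    ((hWW.const_mul_left (a * b)).congr_right (g₂ := fun x => g x * 1) fun x => by ring)
  refine (h.congr_left fun x => ?_).congr_right fun x => mul_one _
  ring

lemma firstOrder_inv (hW : Tendsto W l (𝓝 0)) (hg : Tendsto g l (𝓝 0))
    (hWW : (fun x => W x * W x) =O[l] g)
    (hu : (fun x => u x - (1 - a * W x)) =O[l] g) :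
    (fun x => (u x)⁻¹ - (1 - (-a) * W x)) =O[l] g := by
  have hu1 := tendsto_one_of_firstOrder hW hg hu
  have hi : (fun x => (u x)⁻¹) =O[l] fun _ => (1 : ℝ) :=
    (hu1.inv₀ one_ne_zero).isBigO_one ℝ
  -- 1 + aW is its own expansion with zero error, so u (1 + aW) = 1 + O(g); multiplying by the
  -- bounded u⁻¹ gives the claim.
  have hz : (fun x => (1 - (-a) * W x) - (1 - (-a) * W x)) =O[l] g := by
    simpa using isBigO_zero g l
  have h := (hi.mul (firstOrder_mul hW hg hWW hu hz)).neg_left.congr_right fun x => one_mul (g x)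
  refine h.congr' ?_ EventuallyEq.rfl
  filter_upwards [hu1.eventually_ne one_ne_zero] with x hx
  field_simp
  ring

lemma firstOrder_pow (hW : Tendsto W l (𝓝 0)) (hg : Tendsto g l (𝓝 0))
    (hWW : (fun x => W x * W x) =O[l] g)
    (hu : (fun x => u x - (1 - a * W x)) =O[l] g) (m : ℕ) :
    (fun x => u x ^ m - (1 - (m * a) * W x)) =O[l] g := by
  induction m with
  | zero => simpa using isBigO_zero g l
  | succ m ih =>
    refine (firstOrder_mul hW hg hWW ih hu).congr_left fun x => ?_
    push_cast
    ring

end FirstOrder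

/-- Expansion of the symbols of `Φ ^ m` and `Ψ`, uniformly over all symbols `d` of difference rules
of a given accuracy. -/
lemma exists_symbol_bounds {p m : ℕ} (hp : Odd p) (hm : 1 ≤ m) {c : ℝ}
    (hcint : ∀ k : ℤ, c ≠ (k : ℝ)) (B : ℝ) {κ : ℝ} (hκ : 0 < κ) (g : ℝ)
    (hg : g = fPoly p (Int.fract ((m : ℝ) * c)) - m * fPoly p (Int.fract c)) :
    ∃ C > 0, ∃ c₀ > 0, ∃ η > 0, ∀ (ω : ℝ) (d : ℂ), |ω| < η →
      ‖d - (Complex.I * (ω : ℂ)) ^ (p + 1)‖ ≤ B * |ω| ^ (p + 2) →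
      1 - (g : ℂ) * d ≠ 0 ∧
      ‖(1 - (g : ℂ) * d)⁻¹ * slSymbol p ((m : ℝ) * c) ω - slSymbol p c ω ^ m‖ ≤ C * |ω| ^ (p + 2) ∧
      ‖(1 - (g : ℂ) * d)⁻¹ * slSymbol p ((m : ℝ) * c) ω‖ ≤ 1 - c₀ * |ω| ^ (p + 1) ∧
      ‖Complex.exp (Complex.I * ((ω * ((m : ℝ) * c) : ℝ) : ℂ)) *
        ((1 - (g : ℂ) * d)⁻¹ * slSymbol p ((m : ℝ) * c) ω) - 1‖ < κ := by
  obtain ⟨k, hk⟩ := hp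
  -- Only c must avoid the integers, as the corrected leading coefficient is m f(ε); mc itself may
  -- be an integer.
  have hG := neg_one_pow_mul_fPoly_pos hk (Int.fract_pos.2 (hcint ⌊c⌋)) (Int.fract_lt_one c)
  have hp : Odd p := ⟨k, hk⟩
  set F : ℝ := fPoly p (Int.fract c) with hF
  set Fm : ℝ := fPoly p (Int.fract ((m : ℝ) * c)) with hFm
  set G : ℝ := (-1) ^ (k + 1) * F
  -- Along this filter ω tends to 0 while d ranges over all values allowed by the bound, so `IsBigO`
  -- estimates are uniform in d.
  let l : Filter (ℝ × ℂ) := comap Prod.fst (𝓝 0) ⊓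
    𝓟 {x | ‖x.2 - (Complex.I * (x.1 : ℂ)) ^ (p + 1)‖ ≤ B * |x.1| ^ (p + 2)}
  let W : ℝ × ℂ → ℂ := fun x => (Complex.I * (x.1 : ℂ)) ^ (p + 1)
  let e : ℝ × ℂ → ℝ := fun x => x.1 ^ (p + 2)
  have hω : Tendsto (fun x : ℝ × ℂ => x.1) l (𝓝 0) := tendsto_comap.mono_left inf_le_left
  have hIω : Tendsto (fun x : ℝ × ℂ => Complex.I * (x.1 : ℂ)) l (𝓝 0) := by
    have := (Complex.continuous_ofReal.tendsto 0 |>.comp hω).const_mul Complex.I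
    simpa using this
  have hW : Tendsto W l (𝓝 0) := by
    have := hIω.pow (p + 1)
    simpa using this
  have he : Tendsto e l (𝓝 0) := by
    have := hω.pow (p + 2)
    simpa using this
  have hIωO : (fun x : ℝ × ℂ => Complex.I * (x.1 : ℂ)) =O[l] fun x => x.1 :=
    IsBigO.of_bound 1 (Eventually.of_forall fun x => by simp)
  have hWW : (fun x => W x * W x) =O[l] e := by
    have h1 : (fun x => (Complex.I * (x.1 : ℂ)) ^ p) =O[l] fun _ => (1 : ℝ) :=
      (hIω.pow p).isBigO_one ℝ
    refine ((h1.mul (hIωO.pow (p + 2))).congr_left fun x => ?_).congr_right fun x => one_mul _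
    simp only [W]
    ring
  have hU := (slSymbol_expansion hp c).comp_tendsto hω
  have hUm := (slSymbol_expansion hp ((m : ℝ) * c)).comp_tendsto hω
  have hV : (fun x : ℝ × ℂ => (1 - (g : ℂ) * x.2) - (1 - (g : ℂ) * W x)) =O[l] e := by
    have hd : (fun x : ℝ × ℂ => x.2 - W x) =O[l] e := by
      refine IsBigO.of_bound B (mem_inf_of_right ?_)
      rw [mem_principal]
      intro x hx
      simpa [e, W, abs_pow] using hx
    refine (hd.const_mul_left (-(g : ℂ))).congr_left fun x => ?_
    ring
  let U : ℝ × ℂ → ℂ := fun x =>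
    Complex.exp (Complex.I * ((x.1 * c : ℝ) : ℂ)) * slSymbol p c x.1
  let Q : ℝ × ℂ → ℂ := fun x => (1 - (g : ℂ) * x.2)⁻¹ *
    (Complex.exp (Complex.I * ((x.1 * ((m : ℝ) * c) : ℝ) : ℂ)) * slSymbol p ((m : ℝ) * c) x.1)
  have hUpow : (fun x => U x ^ m - (1 - (m * (F : ℂ)) * W x)) =O[l] e :=
    firstOrder_pow hW he hWW hU m
  have hQ : (fun x => Q x - (1 - (m * (F : ℂ)) * W x)) =O[l] e := by
    refine (firstOrder_mul hW he hWW (firstOrder_inv hW he hWW hV) hUm).congr_left fun x => ?_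
    -- The point of the correction: inverting 1 - gd adds -g to the coarse coefficient and produces
    -- that of λ^m.
    have : -(g : ℂ) + (Fm : ℂ) = m * (F : ℂ) := by
      rw [hg]
      push_cast
      ring
    rw [this]
  obtain ⟨C, hC, hQU⟩ := ((hQ.sub hUpow).congr_left (f₂ := fun x => Q x - U x ^ m)
    fun x => by ring).exists_pos
  obtain ⟨C', hC', hQ'⟩ := hQ.exists_pos
  have hmpos : (0 : ℝ) < m := by exact_mod_cast hm
  have hmG : 0 < m * G := mul_pos hmpos hG
  have hall : ∀ᶠ x in l, 1 - (g : ℂ) * x.2 ≠ 0 ∧ ‖Q x - U x ^ m‖ ≤ C * ‖e x‖ ∧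
      ‖Q x - (1 - (m * (F : ℂ)) * W x)‖ ≤ C' * ‖e x‖ ∧ ‖Q x - 1‖ < κ ∧
      m * G * |x.1| ^ (p + 1) < 1 ∧ C' * |x.1| < m * G / 2 := by
    have habs : Tendsto (fun x : ℝ × ℂ => |x.1|) l (𝓝 0) := by simpa using hω.abs
    refine ((tendsto_one_of_firstOrder hW he hV).eventually_ne one_ne_zero).and
      (hQU.bound.and (hQ'.bound.and (Eventually.and ?_ (Eventually.and ?_ ?_))))
    · have := (tendsto_one_of_firstOrder hW he hQ).eventually (Metric.ball_mem_nhds 1 hκ)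
      simpa only [Metric.mem_ball, dist_eq_norm] using this
    · have := (habs.pow (p + 1)).const_mul (m * G)
      rw [zero_pow (Nat.succ_ne_zero p), mul_zero] at this
      exact this.eventually_lt_const one_pos
    · have := habs.const_mul C'
      rw [mul_zero] at this
      exact this.eventually_lt_const (half_pos hmG)
  rw [eventually_inf_principal, eventually_comap] at hall
  obtain ⟨η, hη, hall⟩ := Metric.eventually_nhds_iff.1 hall
  refine ⟨C, hC, m * G / 2, half_pos hmG, η, hη, fun ω d hωη hd => ?_⟩
  obtain ⟨h1, h2, h3, h4, h5, h6⟩ := hall (by simpa using hωη) (ω, d) rfl hd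
  have hnorm : ∀ t : ℝ, ‖Complex.exp (Complex.I * (t : ℂ))‖ = 1 := fun t => by
    rw [mul_comm, Complex.norm_exp_ofReal_mul_I]
  have hQe : Q (ω, d) = Complex.exp (Complex.I * ((ω * ((m : ℝ) * c) : ℝ) : ℂ)) *
      ((1 - (g : ℂ) * d)⁻¹ * slSymbol p ((m : ℝ) * c) ω) := by
    simp only [Q]
    ring
  have hUe : U (ω, d) ^ m = Complex.exp (Complex.I * ((ω * ((m : ℝ) * c) : ℝ) : ℂ)) *
      slSymbol p c ω ^ m := by
    simp only [U]
    rw [mul_pow, ← Complex.exp_nat_mul]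
    congr 2
    push_cast
    ring
  have hen : ‖e (ω, d)‖ = |ω| ^ (p + 2) := by simp [e]
  rw [hen] at h2 h3
  refine ⟨h1, ?_, ?_, ?_⟩
  · rwa [hQe, hUe, ← mul_sub, norm_mul, hnorm, one_mul] at h2
  · have hWe : (m * (F : ℂ)) * W (ω, d) = ((m * G * |ω| ^ (p + 1) : ℝ) : ℂ) := by
      have hev : Even (p + 1) := hp.add_one
      have hI : Complex.I ^ (p + 1) = (-1) ^ (k + 1) := by
        rw [hk, show 2 * k + 1 + 1 = 2 * (k + 1) by ring, pow_mul, Complex.I_sq]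
      simp only [W, G]
      rw [hev.pow_abs, mul_pow, hI]
      push_cast
      ring
    have hnQ : ‖Q (ω, d)‖ = ‖(1 - (g : ℂ) * d)⁻¹ * slSymbol p ((m : ℝ) * c) ω‖ := by
      rw [hQe, norm_mul, hnorm, one_mul]
    rw [← hnQ]
    rw [hWe] at h3
    have h7 : ‖(1 : ℂ) - ((m * G * |ω| ^ (p + 1) : ℝ) : ℂ)‖ = 1 - m * G * |ω| ^ (p + 1) := by
      rw [← Complex.ofReal_one, ← Complex.ofReal_sub, Complex.norm_real, Real.norm_eq_abs,
        abs_of_pos (sub_pos.2 h5)]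
    have h8 := norm_le_norm_add_norm_sub' (Q (ω, d)) (1 - ((m * G * |ω| ^ (p + 1) : ℝ) : ℂ))
    -- For small ω the remainder takes at most half of the dissipation, whence c₀ = mG/2.
    have h9 : C' * |ω| ^ (p + 2) ≤ m * G / 2 * |ω| ^ (p + 1) := by
      rw [pow_succ' |ω| (p + 1), ← mul_assoc]
      exact mul_le_mul_of_nonneg_right h6.le (by positivity)
    rw [h7] at h8
    linarith
  · rwa [hQe] at h4

/-- By compactness: as 3π/2 < 2π, the only zero in the range is x = 0, which d ≤ |x| excludes. The
bound 3π/2 leaves room for |mθ| ≤ π and a phase |mωc| ≤ π/2. -/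
lemma exists_lower_bound_norm_one_sub_exp {d : ℝ} (hd : 0 < d) :
    ∃ κ > 0, ∀ x : ℝ, d ≤ |x| → |x| ≤ 3 * Real.pi / 2 →
      κ ≤ ‖1 - Complex.exp (-(Complex.I * (x : ℂ)))‖ := by
  have hcpt : IsCompact (Set.Icc (-(3 * Real.pi / 2)) (3 * Real.pi / 2) ∩ {x : ℝ | d ≤ |x|}) :=
    isCompact_Icc.inter_right (isClosed_le continuous_const continuous_abs)
  obtain ⟨κ, hκ, h⟩ := hcpt.exists_forall_le' (a := (0 : ℝ))
    (f := fun x : ℝ => ‖1 - Complex.exp (-(Complex.I * (x : ℂ)))‖)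
    (by fun_prop) (by
      rintro x ⟨⟨hx1, hx2⟩, hx3⟩
      rw [Set.mem_ofPred_eq] at hx3
      rw [norm_pos_iff, sub_ne_zero]
      intro he
      obtain ⟨n, hn⟩ := Complex.exp_eq_one_iff.1 he.symm
      have hn' : x = (-n : ℝ) * (2 * Real.pi) := by
        have h2 : (x : ℂ) * Complex.I = (-n : ℂ) * (2 * Real.pi) * Complex.I := by
          linear_combination -hn
        exact_mod_cast mul_right_cancel₀ Complex.I_ne_zero h2
      have hpi := Real.pi_pos
      have hn1 : (n : ℝ) < 1 := by nlinarith
      have hn2 : (-1 : ℝ) < n := by nlinarith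
      have hn0 : n = 0 := by
        have a1 : n < 1 := by exact_mod_cast hn1
        have a2 : -1 < n := by exact_mod_cast hn2
        omega
      rw [hn', hn0] at hx3
      simp at hx3
      linarith)
  exact ⟨κ, hκ, fun x h1 h2 => h x ⟨abs_le.1 h2, h1⟩⟩

lemma exists_forall_meshWidth_lt {t : ℝ} (ht : 0 < t) : ∃ N : ℕ, ∀ n ≥ N, meshWidth n < t :=
  eventually_atTop.1 <| (tendsto_const_div_atTop_nhds_zero_nat (2 : ℝ)).eventually_lt_const ht

end MGRIT

/-! ### Numerator and denominator of the coarse-grid error -/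

namespace MGRIT

lemma coarseSymbol_sub (m : ℕ) (z w : ℂ) (θ : ℝ) :
    ‖coarseSymbol m z θ - coarseSymbol m w θ‖ = ‖z - w‖ := by
  have he : ‖Complex.exp (-(Complex.I * ((m : ℂ) * (θ : ℂ))))‖ = 1 := by
    have : -(Complex.I * ((m : ℂ) * (θ : ℂ))) = ((-(m * θ) : ℝ) : ℂ) * Complex.I := by
      push_cast
      ring
    rw [this, Complex.norm_exp_ofReal_mul_I]
  rw [coarseSymbol, coarseSymbol, sub_sub_sub_cancel_left, ← sub_mul, norm_mul, he, mul_one,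
    norm_sub_rev]

lemma one_sub_norm_le_norm_coarseSymbol (m : ℕ) (z : ℂ) (θ : ℝ) :
    1 - ‖z‖ ≤ ‖coarseSymbol m z θ‖ := by
  have h := coarseSymbol_sub m z 0 θ
  have h0 : coarseSymbol m 0 θ = 1 := by simp [coarseSymbol]
  rw [h0, sub_zero] at h
  have h2 := norm_sub_norm_le (1 : ℂ) (1 - coarseSymbol m z θ)
  rw [sub_sub_cancel, norm_one, norm_sub_rev, h] at h2
  exact h2

lemma coarseSymbol_eq_shift (m : ℕ) (z : ℂ) (θ x : ℝ) :
    coarseSymbol m z θ = 1 - Complex.exp (Complex.I * ((m * x : ℝ) : ℂ)) * z *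
      Complex.exp (-(Complex.I * ((m * (θ + x) : ℝ) : ℂ))) := by
  rw [coarseSymbol, mul_right_comm, ← Complex.exp_add, mul_comm z]
  congr 3
  push_cast
  ring

/-- Moving the phase e^(imx) from the exponential into z makes the shifted symbol nearly 1, so the
coarse symbol is a perturbation of 1 - e^(-im(θ+x)). -/
lemma sub_le_norm_coarseSymbol (m : ℕ) (z : ℂ) (θ x : ℝ) :
    ‖1 - Complex.exp (-(Complex.I * ((m * (θ + x) : ℝ) : ℂ)))‖
      - ‖Complex.exp (Complex.I * ((m * x : ℝ) : ℂ)) * z - 1‖ ≤ ‖coarseSymbol m z θ‖ := by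
  rw [coarseSymbol_eq_shift m z θ x]
  set E := Complex.exp (-(Complex.I * ((m * (θ + x) : ℝ) : ℂ))) with hE
  set y := Complex.exp (Complex.I * ((m * x : ℝ) : ℂ)) * z
  have he : ‖E‖ = 1 := by
    rw [hE, ← mul_neg, ← Complex.ofReal_neg, mul_comm, Complex.norm_exp_ofReal_mul_I]
  have h1 : ‖(y - 1) * E‖ = ‖y - 1‖ := by rw [norm_mul, he, mul_one]
  have h2 : 1 - y * E = (1 - E) - (y - 1) * E := by ring
  rw [h2, ← h1]
  exact norm_sub_norm_le _ _

end MGRIT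

/-! ### Assembly of the estimates -/

theorem theorem6p3 (p s m : ℕ) (hp : Odd p) (hs : 1 ≤ s) (hm : 1 ≤ m)
    (α c : ℝ) (hα : 0 < α) (hc : 0 < c) (hcint : ∀ k : ℤ, c ≠ (k : ℝ))
    (D : ∀ (n : ℕ) [NeZero n], Matrix (ZMod n) (ZMod n) ℝ)
    (hD : MGRIT.IsDifferenceRule D (p + 1) s)
    (K δ : ℝ) (hK : 0 < K) (hδ : 0 < δ) :
    ∃ (C : ℝ) (N : ℕ), ∀ (n : ℕ) [NeZero n], N ≤ n →
      ∀ δt : ℝ, MGRIT.cfl α (MGRIT.meshWidth n) δt = c →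
      IsUnit (MGRIT.correctionMatrix p m α δt n (D n)) →
      ∀ ω : ℝ, MGRIT.IsSpatialFrequency n ω → ω ≠ 0 → |ω| ≤ K * MGRIT.meshWidth n →
      ∃ lam mu : ℂ,
        MGRIT.HasFourierSymbol (MGRIT.semiLagrangian p α δt n) ω lam ∧
        MGRIT.HasFourierSymbol (MGRIT.modifiedCoarse p m α δt n (D n)) ω mu ∧
        ∀ θ ∈ MGRIT.lowFrequencies m,
          MGRIT.coarseSymbol m mu θ ≠ 0 ∧
          (δ ≤ |θ - -(ω * α * δt / MGRIT.meshWidth n)| →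
            MGRIT.coarseGridError m lam mu θ ≤ C * |ω| ^ (p + 2)) ∧
          (|θ - -(ω * α * δt / MGRIT.meshWidth n)| < δ →
            MGRIT.coarseGridError m lam mu θ ≤ C * |ω|) := by
  have hmpos : (0 : ℝ) < m := by exact_mod_cast hm
  have hpi := Real.pi_pos
  -- the difference rule, uniformly over the finitely many admissible wave numbers
  obtain ⟨q, hq⟩ : ∃ q, p + 1 = 2 * q := by
    obtain ⟨k, rfl⟩ := hp
    exact ⟨k + 1, by ring⟩
  have hDq := hD
  rw [hq] at hDq
  choose B₁ N₁ hB₁ using fun l : ℤ => hDq.symbol_bound l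
  let L : Finset ℤ := Finset.Icc (-⌈K⌉) ⌈K⌉
  -- The sum of absolute values serves as an upper bound for every `B₁ l` with l in `L`.
  let B : ℝ := ∑ l ∈ L, |B₁ l|
  have hBnn : 0 ≤ B := Finset.sum_nonneg fun l _ => abs_nonneg _
  obtain ⟨κ, hκ, hκx⟩ := MGRIT.exists_lower_bound_norm_one_sub_exp (mul_pos hmpos hδ)
  obtain ⟨C, hC, c₀, hc₀, η, hη, hmain⟩ :=
    MGRIT.exists_symbol_bounds hp hm hcint B (half_pos hκ) _ rfl
  -- The three thresholds give |ω| < η, |mωc| ≤ π/2 and h < 1.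
  obtain ⟨N₂, hN₂⟩ := MGRIT.exists_forall_meshWidth_lt (div_pos hη hK)
  obtain ⟨N₃, hN₃⟩ := MGRIT.exists_forall_meshWidth_lt
    (show 0 < Real.pi / 2 / (m * c * K) by positivity)
  obtain ⟨N₄, hN₄⟩ := MGRIT.exists_forall_meshWidth_lt one_pos
  refine ⟨C / c₀ + C / (κ / 2), L.sup N₁ + N₂ + N₃ + N₄, ?_⟩
  intro n _ hn δt hcfl hunit ω hω hω0 hωK
  have hh := MGRIT.meshWidth_pos n
  have hhη := hN₂ n (by omega)
  have hhm := hN₃ n (by omega)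
  have hh1 := hN₄ n (by omega)
  set h := MGRIT.meshWidth n with hhdef
  rw [lt_div_iff₀ (by positivity)] at hhη hhm
  obtain ⟨l, hl⟩ := hω.2
  have hωl : ω = Real.pi * l * h := by
    have hn0 : (n : ℝ) ≠ 0 := by exact_mod_cast NeZero.ne n
    rw [hhdef, MGRIT.meshWidth]
    field_simp
    linarith
  have hl1 : (1 : ℝ) ≤ |(l : ℝ)| := by
    have : l ≠ 0 := by
      rintro rfl
      simp [hωl] at hω0
    exact_mod_cast Int.one_le_abs this
  have hωabs : |ω| = Real.pi * |(l : ℝ)| * h := by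
    rw [hωl, abs_mul, abs_mul, abs_of_pos hpi, abs_of_pos hh]
  have hpi1 : 1 ≤ Real.pi := by linarith [Real.pi_gt_three]
  -- A nonzero frequency is at least πh in modulus, so powers of h are bounded by powers of |ω|.
  have hhω : h ≤ |ω| := by
    rw [hωabs]
    exact le_mul_of_one_le_left hh.le (one_le_mul_of_one_le_of_one_le hpi1 hl1)
  have hωpos : 0 < |ω| := abs_pos.2 hω0
  have hlL : l ∈ L := by
    have h1 : |(l : ℝ)| ≤ K := by
      have h2 : Real.pi * |(l : ℝ)| ≤ K := by
        rw [hωabs] at hωK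
        exact le_of_mul_le_mul_right hωK hh
      exact (le_mul_of_one_le_left (abs_nonneg _) hpi1).trans h2
    have h2 : |l| ≤ ⌈K⌉ := by
      have h3 : ((|l| : ℤ) : ℝ) ≤ ⌈K⌉ := by
        push_cast
        exact h1.trans (Int.le_ceil K)
      exact_mod_cast h3
    exact Finset.mem_Icc.2 (abs_le.1 h2)
  -- the symbols
  have hcflm : MGRIT.cfl α h (m * δt) = m * c := by
    rw [← hcfl, MGRIT.cfl, MGRIT.cfl]
    ring
  obtain ⟨a, ha⟩ := hD.1 n
  obtain ⟨d, hd⟩ : ∃ d, MGRIT.HasFourierSymbol (D n) ω d := by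
    rw [ha]
    exact MGRIT.exists_hasFourierSymbol_circulant a hω
  have hdB : ‖d - (Complex.I * (ω : ℂ)) ^ (p + 1)‖ ≤ B * |ω| ^ (p + 2) := by
    have hNl : N₁ l ≤ n := (Finset.le_sup hlL).trans (by omega)
    have h1 := hB₁ l n hNl d (hωl ▸ hd)
    rw [← hhdef, ← hωl, ← hq] at h1
    refine h1.trans ?_
    have h2 : B₁ l ≤ B := (le_abs_self _).trans
      (Finset.single_le_sum (f := fun l => |B₁ l|) (fun _ _ => abs_nonneg _) hlL)
    have h3 : h ^ (p + 1 + s) ≤ |ω| ^ (p + 2) :=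
      -- Here s ≥ 1 enters: the error of the rule is at least one order beyond (iω)^(p+1).
      (pow_le_pow_of_le_one hh.le hh1.le (by omega)).trans (pow_le_pow_left₀ hh.le hhω _)
    exact mul_le_mul h2 h3 (by positivity) hBnn
  obtain ⟨hne, hdiff, hnorm, hclose⟩ := hmain ω d
    (lt_of_le_of_lt hωK (by rwa [mul_comm])) hdB
  have hcorr : MGRIT.correctionMatrix p m α δt n (D n)
      = 1 - (MGRIT.fPoly p (Int.fract (m * c)) - m * MGRIT.fPoly p (Int.fract c)) • D n := by
    rw [MGRIT.correctionMatrix, MGRIT.cflFrac, MGRIT.cflFrac, hcfl, hcflm, Int.fract, Int.fract]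
  refine ⟨MGRIT.slSymbol p c ω, _, MGRIT.hasFourierSymbol_semiLagrangian p hcfl hω,
    MGRIT.HasFourierSymbol.inv_mul (by rw [hcorr]; exact hd.one_sub_smul _)
      (MGRIT.hasFourierSymbol_semiLagrangian p hcflm hω) hunit hne, fun θ hθ => ?_⟩
  set g : ℝ := MGRIT.fPoly p (Int.fract (m * c)) - m * MGRIT.fPoly p (Int.fract c)
  set mu : ℂ := (1 - (g : ℂ) * d)⁻¹ * MGRIT.slSymbol p (m * c) ω
  have hlow : c₀ * |ω| ^ (p + 1) ≤ ‖MGRIT.coarseSymbol m mu θ‖ := by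
    have := MGRIT.one_sub_norm_le_norm_coarseSymbol m mu θ
    linarith
  have hlowpos : 0 < c₀ * |ω| ^ (p + 1) := by positivity
  refine ⟨norm_pos_iff.1 (hlowpos.trans_le hlow), fun hθδ => ?_, fun _ => ?_⟩
  · have hchar : ω * α * δt / h = ω * c := by
      rw [← hcfl, MGRIT.cfl]
      ring
    rw [hchar, sub_neg_eq_add] at hθδ
    have hθm : |m * θ| ≤ Real.pi := by
      rw [abs_mul, abs_of_pos hmpos, ← le_div_iff₀' hmpos]
      exact abs_le.2 ⟨hθ.1, hθ.2.le⟩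
    have hωm : |m * (ω * c)| ≤ Real.pi / 2 := by
      rw [abs_mul, abs_mul, abs_of_pos hmpos, abs_of_pos hc]
      calc m * (|ω| * c) ≤ m * (K * h * c) := by gcongr
        _ = h * (m * c * K) := by ring
        _ ≤ _ := hhm.le
    have h1 := hκx (m * (θ + ω * c))
      (by rw [abs_mul, abs_of_pos hmpos]; gcongr)
      (by
        rw [mul_add]
        refine (abs_add_le _ _).trans ?_
        linarith)
    have h2 := MGRIT.sub_le_norm_coarseSymbol m mu θ (ω * c)
    rw [mul_left_comm (m : ℝ) ω c] at h2
    have h3 : κ / 2 ≤ ‖MGRIT.coarseSymbol m mu θ‖ := by linarith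
    rw [MGRIT.coarseGridError, MGRIT.coarseSymbol_sub]
    calc _ ≤ C * |ω| ^ (p + 2) / (κ / 2) := by gcongr
      _ = C / (κ / 2) * |ω| ^ (p + 2) := by ring
      _ ≤ _ := by
        gcongr
        exact le_add_of_nonneg_left (by positivity)
  · rw [MGRIT.coarseGridError, MGRIT.coarseSymbol_sub]
    calc _ ≤ C * |ω| ^ (p + 2) / (c₀ * |ω| ^ (p + 1)) := by gcongr
      _ = C / c₀ * |ω| := by
        have : |ω| ≠ 0 := hωpos.ne'
        field_simp
        ring
      _ ≤ _ := by
        gcongr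
        exact le_add_of_nonneg_right (by positivity)
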